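/- Let $\mathbb T=\mathbb R/2\pi\mathbb Z$ be the circle with normalized Haar measure $d\theta/2\pi$. A \emph{weight} is a function $w\in L^1(\mathbb T)$ with $w\ge 0$ a.e. and $w>0$ on a set of positive measure. Let $L^2(w)=L^2(\mathbb T;\,w\,d\theta/2\pi)$ be the space of complex-valued functions that are square integrable with respect to $w\,d\theta/2\pi$, and let $H^2(w)$ be the closed linear span of $\{e^{in\theta}: n\ge 0\}$ in $L^2(w)$. The weight $w$ is called an \emph{$A_2$-weight} if there is a bounded projection $R$ of $L^2(w)$ onto $H^2(w)$ with $R(e^{in\theta})=0$ for all $n<0$; this $R$ is then unique and is called the Riesz projection of $L^2(w)$, and $\|R\|_w$ denotes its operator norm on $L^2(w)$. Let $H^1$ be the space of all complex-valued $h\in L^1(\mathbb T)$ whose Fourier coefficients satisfy $\hat h(n)=\int_{\mathbb T}h(\theta)e^{-in\theta}\,\frac{d\theta}{2\pi}=0$ for all $n<0$. Let $w$ be a weight on $\mathbb T$ and let $0\le\varphi<\frac{\pi}{2}$. Then the following two conditions are equivalent: (1) $w$ is an $A_2$-weight and $\|R\|_w\le\sec\varphi$; (2) there exists $h\in H^1$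 such that $|w-h|\le w\sin\varphi$ almost everywhere on $\mathbb T$. -/

import Mathlib

open MeasureTheory AddCircle

noncomputable section

instance factTwoPiPos : Fact (0 < 2 * Real.pi) := ⟨Real.two_pi_pos⟩

/-- A weight on the circle `ℝ / 2πℤ`: a nonnegative integrable function which is positive on a
set of positive measure. -/
structure IsWeight (w : AddCircle (2 * Real.pi) → ℝ) : Prop where
  integrable : Integrable w haarAddCircle
  nonneg : ∀ᵐ t ∂haarAddCircle, 0 ≤ w t
  pos : 0 < haarAddCircle {t | 0 < w t}

/-- The measure `w dθ / 2π`. -/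
def weightMeasure (w : AddCircle (2 * Real.pi) → ℝ) : Measure (AddCircle (2 * Real.pi)) :=
  haarAddCircle.withDensity fun t => ENNReal.ofReal (w t)

theorem IsWeight.isFiniteMeasure {w : AddCircle (2 * Real.pi) → ℝ} (hw : IsWeight w) :
    IsFiniteMeasure (weightMeasure w) :=
  isFiniteMeasure_withDensity_ofReal hw.integrable.2

/-- The weighted space `L²(w)`, with the norm `f ↦ (∫ |f|² w dθ / 2π)^(1/2)`. -/
abbrev WeightedL2 (w : AddCircle (2 * Real.pi) → ℝ) : Type :=
  Lp ℂ 2 (weightMeasure w)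

/-- The exponential `e^{inθ}` as an element of `L²(w)`. -/
def IsWeight.exponential {w : AddCircle (2 * Real.pi) → ℝ} (hw : IsWeight w) (n : ℤ) :
    WeightedL2 w :=
  haveI := hw.isFiniteMeasure
  ContinuousMap.toLp (E := ℂ) 2 (weightMeasure w) ℂ (fourier n)

/-- `H²(w)`, the closed linear span in `L²(w)` of the exponentials `e^{inθ}`, `n ≥ 0`. -/
def IsWeight.hardyTwo {w : AddCircle (2 * Real.pi) → ℝ} (hw : IsWeight w) :
    Submodule ℂ (WeightedL2 w) :=
  (Submodule.span ℂ {f | ∃ n : ℤ, 0 ≤ n ∧ f = hw.exponential n}).topologicalClosure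

/-- `R` is a bounded projection of `L²(w)` onto `H²(w)` with `R(e^{inθ}) = 0` for `n < 0`. -/
structure IsWeight.IsRieszProjection {w : AddCircle (2 * Real.pi) → ℝ} (hw : IsWeight w)
    (R : WeightedL2 w →L[ℂ] WeightedL2 w) : Prop where
  idempotent : ∀ f, R (R f) = R f
  range_eq : LinearMap.range (R : WeightedL2 w →ₗ[ℂ] WeightedL2 w) = hw.hardyTwo
  map_exponential : ∀ n : ℤ, n < 0 → R (hw.exponential n) = 0

/-- `w` is an `A₂`-weight: there is a bounded projection of `L²(w)` onto `H²(w)` which kills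
`e^{inθ}` for `n < 0`. -/
def IsWeight.IsA2 {w : AddCircle (2 * Real.pi) → ℝ} (hw : IsWeight w) : Prop :=
  ∃ R : WeightedL2 w →L[ℂ] WeightedL2 w, hw.IsRieszProjection R

theorem IsWeight.span_exponential {w : AddCircle (2 * Real.pi) → ℝ} (hw : IsWeight w) :
    (Submodule.span ℂ (Set.range hw.exponential)).topologicalClosure = ⊤ := by
  have := hw.isFiniteMeasure
  have h := (ContinuousMap.toLp_denseRange ℂ (weightMeasure w) ℂ
    (p := 2) (by simp)).topologicalClosure_map_submodule
      (span_fourier_closure_eq_top (T := 2 * Real.pi))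
  rw [Submodule.map_span, ← Set.range_comp] at h
  exact h

/-- The projection in the definition of an `A₂`-weight is unique. -/
theorem IsWeight.IsRieszProjection.unique {w : AddCircle (2 * Real.pi) → ℝ} {hw : IsWeight w}
    {R S : WeightedL2 w →L[ℂ] WeightedL2 w} (hR : hw.IsRieszProjection R)
    (hS : hw.IsRieszProjection S) : R = S := by
  have key : ∀ {Q : WeightedL2 w →L[ℂ] WeightedL2 w}, hw.IsRieszProjection Q →
      ∀ n : ℤ, 0 ≤ n → Q (hw.exponential n) = hw.exponential n := by
    intro Q hQ n hn
    have hmem : hw.exponential n ∈ hw.hardyTwo :=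
      Submodule.le_topologicalClosure _ (Submodule.subset_span ⟨n, hn, rfl⟩)
    rw [← hQ.range_eq] at hmem
    obtain ⟨f, hf⟩ := hmem
    have hf2 : Q f = hw.exponential n := hf
    rw [← hf2, hQ.idempotent]
  refine ContinuousLinearMap.ext_on (s := Set.range hw.exponential) ?_ ?_
  · exact Submodule.dense_iff_topologicalClosure_eq_top.mpr hw.span_exponential
  · rintro _ ⟨n, rfl⟩
    rcases lt_or_ge n 0 with hn | hn
    · rw [hR.map_exponential n hn, hS.map_exponential n hn]
    · rw [key hR n hn, key hS n hn]

open Classical in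
/-- The Riesz projection of `L²(w)` onto `H²(w)`; it is meaningful for `A₂`-weights only, and is
set to `0` otherwise. -/
def IsWeight.rieszProjection {w : AddCircle (2 * Real.pi) → ℝ} (hw : IsWeight w) :
    WeightedL2 w →L[ℂ] WeightedL2 w :=
  if h : hw.IsA2 then h.choose else 0

theorem IsWeight.IsA2.isRieszProjection {w : AddCircle (2 * Real.pi) → ℝ} {hw : IsWeight w}
    (h : hw.IsA2) : hw.IsRieszProjection hw.rieszProjection := by
  rw [IsWeight.rieszProjection, dif_pos h]
  exact h.choose_spec

/-- The Hardy space `H¹` of the circle: integrable functions whose Fourier coefficients of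
negative index vanish. -/
structure MemHardyOne (h : AddCircle (2 * Real.pi) → ℂ) : Prop where
  integrable : Integrable h haarAddCircle
  fourierCoeff_eq_zero : ∀ n : ℤ, n < 0 → fourierCoeff h n = 0

end

/-! Write `s = sin φ` and `c = cos φ`. An oblique projection has norm at most `1 / c` exactly when
the cosine of the angle between its range and its kernel is at most `s`. Antianalytic trigonometric
polynomials are the conjugates of `e^{iθ} q`, so condition (1) says that `|∫ e^{iθ} p q w| ≤ s ‖p‖
‖q‖` in `L²(w)` for all polynomials `p`, `q` (`isA2_and_norm_le_iff_polynomial`).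

Given `h`, the integral of `e^{iθ} p q h` vanishes. Hence `w` may be replaced by `w - h`, and `|w -
h| ≤ s w` with Cauchy–Schwarz gives this bound (`norm_inner_le_of_memHardyOne`).

Conversely, each polynomial `p` is a product `f g` in the disc algebra with `|f|² = |g|² = |p|` on
the circle (`Polynomial.hasBalancedFactorization`). Approximating `f` and `g` by polynomials turns
the bilinear bound into `|∫ e^{iθ} p w| ≤ s ∫ |p| w` (`norm_integral_circlePolynomial_le`). By
Hahn–Banach, this functional of `p` is integration against some `ψ` with `|ψ| ≤ s`
(`exists_bounded_density`), and `h = w - e^{-iθ} ψ w` works (`exists_memHardyOne`). -/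

/-! ### Disc algebra: polynomial approximation and balanced factorization -/

open Polynomial in
/-- A function continuous on the closed unit disc and holomorphic inside is a uniform limit of
polynomials. -/
theorem DiffContOnCl.exists_polynomial_near {G : ℂ → ℂ}
    (hG : DiffContOnCl ℂ G (Metric.ball 0 1)) {ε : ℝ} (hε : 0 < ε) :
    ∃ p : ℂ[X], ∀ z : ℂ, ‖z‖ ≤ 1 → ‖p.eval z - G z‖ < ε := by
  have huc : UniformContinuousOn G (Metric.closedBall 0 1) :=
    (isCompact_closedBall _ _).uniformContinuousOn_of_continuous hG.continuousOn_ball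
  obtain ⟨δ, hδ, hd⟩ := Metric.uniformContinuousOn_iff.1 huc (ε / 2) (half_pos hε)
  -- The approximant is a Taylor polynomial of the dilate `G (r z)`: `r < 1` makes the Taylor series
  -- converge uniformly, and `r > 1 - δ` makes the dilation move points of the disc by less than
  -- `δ`.
  obtain ⟨r, hr1, hr2⟩ : ∃ r : ℝ, max 0 (1 - δ) < r ∧ r < 1 :=
    exists_between (max_lt one_pos (by linarith))
  obtain ⟨hr0, hrδ⟩ := max_lt_iff.1 hr1
  obtain ⟨r', hrr', hr'1⟩ := exists_between hr2
  lift r' to NNReal using (hr0.trans hrr').le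
  have hps := DiffContOnCl.hasFPowerSeriesOnBall (R := 1) (by simpa using hG) one_pos
  set P := cauchyPowerSeries G 0 (1 : NNReal)
  have hu := hps.tendstoUniformlyOn (r' := r') (by exact_mod_cast hr'1)
  obtain ⟨n, hn⟩ := (Metric.tendstoUniformlyOn_iff.1 hu (ε / 2) (half_pos hε)).exists
  refine ⟨∑ k ∈ Finset.range n, C (P.coeff k * (r : ℂ) ^ k) * X ^ k, fun z hz => ?_⟩
  have hrz : ‖(r : ℂ) * z‖ ≤ r := by
    rw [norm_mul, Complex.norm_real, Real.norm_of_nonneg hr0.le]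
    exact mul_le_of_le_one_right hr0.le hz
  have h1 := hn ((r : ℂ) * z) (by simpa using hrz.trans_lt hrr')
  have h2 := hd ((r : ℂ) * z) (by simpa using hrz.trans hr2.le) z (by simpa using hz) (by
    rw [dist_eq_norm, show (r : ℂ) * z - z = ((r - 1 : ℝ) : ℂ) * z by push_cast; ring, norm_mul,
      Complex.norm_real, Real.norm_eq_abs, abs_of_neg (by linarith)]
    nlinarith [norm_nonneg z])
  have h3 : (∑ k ∈ Finset.range n, C (P.coeff k * (r : ℂ) ^ k) * X ^ k).eval z
      = P.partialSum n ((r : ℂ) * z) := by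
    simp only [FormalMultilinearSeries.partialSum, eval_finsetSum,
      FormalMultilinearSeries.apply_eq_pow_smul_coeff, eval_mul, eval_C, eval_pow, eval_X,
      smul_eq_mul, mul_pow]
    exact Finset.sum_congr rfl fun k _ => by ring
  rw [h3, ← dist_eq_norm]
  rw [zero_add, dist_comm] at h1
  linarith [dist_triangle (P.partialSum n ((r : ℂ) * z)) (G ((r : ℂ) * z)) (G z)]

theorem Complex.cpow_half_mul_self (x : ℂ) : x ^ (1 / 2 : ℂ) * x ^ (1 / 2 : ℂ) = x := by
  rw [← pow_two, one_div]
  exact_mod_cast Complex.cpow_nat_inv_pow x two_ne_zero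

theorem Complex.norm_cpow_half_sq (x : ℂ) : ‖x ^ (1 / 2 : ℂ)‖ ^ 2 = ‖x‖ := by
  rw [pow_two, ← norm_mul, Complex.cpow_half_mul_self]

/-- The principal square root of `1 - c z` is continuous on the closed unit disc and holomorphic
inside when `|c| ≤ 1`. -/
theorem diffContOnCl_cpow_half_one_sub {c : ℂ} (hc : ‖c‖ ≤ 1) :
    DiffContOnCl ℂ (fun z => (1 - c * z) ^ (1 / 2 : ℂ)) (Metric.ball 0 1) := by
  have hlt : ∀ u : ℂ, u.re < 1 → 1 - u ∈ Complex.slitPlane := fun u hu =>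
    Complex.mem_slitPlane_iff.2 (Or.inl (by simpa using hu))
  have hcz : ∀ z : ℂ, ‖z‖ ≤ 1 → ‖c * z‖ ≤ ‖z‖ := fun z hz => by
    rw [norm_mul]; exact mul_le_of_le_one_left (norm_nonneg z) hc
  refine DiffContOnCl.mk_ball (fun z hz => ?_) fun z hz => ?_
  · rw [mem_ball_zero_iff] at hz
    refine (DifferentiableAt.cpow (f := fun z : ℂ => 1 - c * z) (g := fun _ => (1 / 2 : ℂ))
      (by fun_prop) (by fun_prop) (hlt _ ?_)).differentiableWithinAt
    exact (Complex.re_le_norm _).trans_lt ((hcz z hz.le).trans_lt hz)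
  · rw [mem_closedBall_zero_iff] at hz
    have hin : ContinuousAt (fun z : ℂ => 1 - c * z) z := by fun_prop
    have hout : ContinuousAt (fun x : ℂ => x ^ (1 / 2 : ℂ)) (1 - c * z) := by
      -- `1 - c z` stays in the closed right half-plane and meets the branch cut only at `0`. There
      -- the root is still continuous, because its exponent has positive real part.
      by_cases h1 : c * z = 1
      · rw [h1, sub_self]
        have h0 := Complex.continuousAt_cpow_zero_of_re_pos (z := 1 / 2) (by norm_num)
        exact h0.comp (f := fun x : ℂ => (x, (1 / 2 : ℂ))) (by fun_prop)
      · refine continuousAt_cpow_const (hlt _ ?_)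
        refine lt_of_le_of_ne ((Complex.re_le_norm _).trans ((hcz z hz).trans hz)) fun hre => h1 ?_
        have hn := (hcz z hz).trans hz
        have hsq := Complex.sq_norm (c * z)
        rw [Complex.normSq_apply, hre] at hsq
        have him : (c * z).im = 0 := by nlinarith [norm_nonneg (c * z)]
        exact Complex.ext (by simpa using hre) (by simpa using him)
    exact (ContinuousAt.comp (f := fun z : ℂ => 1 - c * z)
      (g := fun x : ℂ => x ^ (1 / 2 : ℂ)) hout hin).continuousWithinAt

/-- `F` is a product of two functions of the disc algebra, both of modulus `|F| ^ (1 / 2)` on the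
unit circle. -/
def HasBalancedFactorization (F : ℂ → ℂ) : Prop :=
  ∃ f g : ℂ → ℂ, DiffContOnCl ℂ f (Metric.ball 0 1) ∧ DiffContOnCl ℂ g (Metric.ball 0 1) ∧
    ∀ z : ℂ, ‖z‖ = 1 → F z = f z * g z ∧ ‖f z‖ ^ 2 = ‖F z‖ ∧ ‖g z‖ ^ 2 = ‖F z‖

theorem HasBalancedFactorization.mul {F G : ℂ → ℂ} (hF : HasBalancedFactorization F)
    (hG : HasBalancedFactorization G) : HasBalancedFactorization fun z => F z * G z := by
  obtain ⟨f, g, hf, hg, h⟩ := hF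
  obtain ⟨f', g', hf', hg', h'⟩ := hG
  refine ⟨fun z => f z • f' z, fun z => g z • g' z, hf.smul hf', hg.smul hg', fun z hz => ?_⟩
  obtain ⟨h1, h2, h3⟩ := h z hz
  obtain ⟨h1', h2', h3'⟩ := h' z hz
  simp only [smul_eq_mul, norm_mul, mul_pow, h2, h3, h2', h3', and_self, and_true]
  rw [h1, h1']; ring

theorem HasBalancedFactorization.const (c : ℂ) : HasBalancedFactorization fun _ => c :=
  ⟨fun _ => c ^ (1 / 2 : ℂ), fun _ => c ^ (1 / 2 : ℂ), diffContOnCl_const, diffContOnCl_const,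
    fun _ _ => ⟨(Complex.cpow_half_mul_self c).symm, Complex.norm_cpow_half_sq c,
      Complex.norm_cpow_half_sq c⟩⟩

theorem HasBalancedFactorization.one_sub_mul {c : ℂ} (hc : ‖c‖ ≤ 1) :
    HasBalancedFactorization fun z => 1 - c * z :=
  ⟨_, _, diffContOnCl_cpow_half_one_sub hc, diffContOnCl_cpow_half_one_sub hc,
    fun _ _ => ⟨(Complex.cpow_half_mul_self _).symm, Complex.norm_cpow_half_sq _,
      Complex.norm_cpow_half_sq _⟩⟩

/-- If `|a| ≥ 1`, then `z - a = -a (1 - a⁻¹ z)` has a square root on the disc. A zero inside the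
disc forbids this, so the Blaschke factor `(z - a) / (1 - ā z)`, unimodular on the circle, goes
whole into one factor, and only the zero-free `1 - ā z` is split by a square root. -/
theorem HasBalancedFactorization.sub_const (a : ℂ) : HasBalancedFactorization fun z => z - a := by
  rcases le_or_gt 1 ‖a‖ with ha | ha
  · have ha0 : a ≠ 0 := norm_pos_iff.1 (one_pos.trans_le ha)
    convert (HasBalancedFactorization.const (-a)).mul
      (HasBalancedFactorization.one_sub_mul (c := a⁻¹) (by
        rw [norm_inv]; exact inv_le_one_of_one_le₀ ha)) using 2 with z
    field_simp
    ring
  · have hne : ∀ z : ℂ, ‖z‖ ≤ 1 → 1 - (starRingEnd ℂ) a * z ≠ 0 := fun z hz h => by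
      have h1 : ‖(starRingEnd ℂ) a * z‖ = 1 := by rw [← sub_eq_zero.1 h, norm_one]
      rw [norm_mul, Complex.norm_conj] at h1
      nlinarith [norm_nonneg a, norm_nonneg z]
    have hs := diffContOnCl_cpow_half_one_sub (c := (starRingEnd ℂ) a)
      (by rw [Complex.norm_conj]; exact ha.le)
    have hB : DiffContOnCl ℂ (fun z => (1 - (starRingEnd ℂ) a * z)⁻¹) (Metric.ball 0 1) := by
      refine DiffContOnCl.inv (f := fun z => 1 - (starRingEnd ℂ) a * z)
        (Differentiable.diffContOnCl (by fun_prop)) fun z hz => hne z ?_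
      rw [closure_ball _ one_ne_zero] at hz
      simpa using hz
    have hA : DiffContOnCl ℂ (fun z => z - a) (Metric.ball 0 1) :=
      Differentiable.diffContOnCl (by fun_prop)
    refine ⟨_, _, (hA.smul hB).smul hs, hs, fun z hz => ?_⟩
    have hnorm : ‖1 - (starRingEnd ℂ) a * z‖ = ‖z - a‖ := by
      have hzz : z * (starRingEnd ℂ) z = 1 := by
        rw [Complex.mul_conj, Complex.normSq_eq_norm_sq, hz]; norm_num
      have : 1 - (starRingEnd ℂ) a * z = z * (starRingEnd ℂ) (z - a) := by
        rw [map_sub, mul_sub, hzz]; ring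
      rw [this, norm_mul, hz, Complex.norm_conj, one_mul]
    have hne' := hne z hz.le
    simp only [smul_eq_mul, norm_mul, mul_pow, Complex.norm_cpow_half_sq, hnorm, norm_inv, and_true]
    constructor
    · rw [mul_assoc, Complex.cpow_half_mul_self, mul_assoc, inv_mul_cancel₀ hne', mul_one]
    · have : ‖z - a‖ ≠ 0 := by rw [← hnorm]; exact norm_ne_zero_iff.2 hne'
      field_simp

open Polynomial in
theorem Polynomial.hasBalancedFactorization (p : ℂ[X]) :
    HasBalancedFactorization fun z => p.eval z := by
  have key : ∀ s : Multiset ℂ,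
      HasBalancedFactorization fun z => ((s.map fun a => X - C a).prod).eval z := fun s => by
    induction s using Multiset.induction with
    | empty => simpa using HasBalancedFactorization.const 1
    | cons a s ih => simpa using (HasBalancedFactorization.sub_const a).mul ih
  rw [(IsAlgClosed.splits p).eq_prod_roots]
  simpa only [eval_mul, eval_C] using
    (HasBalancedFactorization.const p.leadingCoeff).mul (key p.roots)

/-! ### Oblique projections and the angle between subspaces -/

section AngleProjection

variable {E : Type*} [NormedAddCommGroup E] [InnerProductSpace ℂ E]

/-- If the oblique projection along `K` onto `H` has norm at most `1 / c`, then the cosine of the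
angle between `H` and `K` is at most `s`, where `s² + c² = 1`. -/
theorem norm_inner_le_of_norm_le_norm_add {H K : Submodule ℂ E} {s c : ℝ} (hs : 0 ≤ s)
    (hsc : s ^ 2 + c ^ 2 = 1)
    (h : ∀ f ∈ H, ∀ g ∈ K, c ^ 2 * ‖f‖ ^ 2 ≤ ‖f + g‖ ^ 2) :
    ∀ f ∈ H, ∀ g ∈ K, ‖inner ℂ f g‖ ≤ s * ‖f‖ * ‖g‖ := by
  intro f hf g hg
  rcases eq_or_ne g 0 with rfl | hg0
  · simp
  have hgn : 0 < ‖g‖ := norm_pos_iff.2 hg0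
  -- With this choice `f + a g` is the component of `f` orthogonal to `g`, so the hypothesis is used
  -- where it is sharpest.
  set a : ℂ := -(inner ℂ g f / (‖g‖ ^ 2 : ℝ)) with ha
  have h1 := h f hf (a • g) (K.smul_mem a hg)
  rw [@norm_add_sq ℂ, norm_smul, inner_smul_right] at h1
  have h2 : a * inner ℂ f g = ((-(‖inner ℂ f g‖ ^ 2 / ‖g‖ ^ 2) : ℝ) : ℂ) := by
    rw [ha, ← inner_conj_symm g f]
    have := Complex.conj_mul' (inner ℂ f g)
    push_cast
    rw [← this]; ring
  have h3 : ‖a‖ = ‖inner ℂ f g‖ / ‖g‖ ^ 2 := by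
    rw [ha, norm_neg, norm_div, ← inner_conj_symm g f, Complex.norm_conj, Complex.norm_real,
      Real.norm_of_nonneg (by positivity)]
  rw [h2, h3, RCLike.re_eq_complex_re, Complex.ofReal_re] at h1
  have h4 : ‖inner ℂ f g‖ / ‖g‖ ^ 2 * ‖g‖ = ‖inner ℂ f g‖ / ‖g‖ := by field_simp
  rw [h4, div_pow] at h1
  have h5 : ‖inner ℂ f g‖ ^ 2 / ‖g‖ ^ 2 ≤ s ^ 2 * ‖f‖ ^ 2 := by
    have : c ^ 2 = 1 - s ^ 2 := by linarith
    rw [this] at h1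
    linarith
  rw [div_le_iff₀ (by positivity)] at h5
  exact (sq_le_sq₀ (norm_nonneg _) (by positivity)).1 (by nlinarith)

/-- Complete the square: `‖f‖² - 2 s ‖f‖ ‖g‖ + ‖g‖² = (1 - s²) ‖f‖² + (s ‖f‖ - ‖g‖)²`. -/
theorem norm_le_norm_add_of_norm_inner_le {s c : ℝ} (hsc : s ^ 2 + c ^ 2 = 1) {f g : E}
    (h : ‖inner ℂ f g‖ ≤ s * ‖f‖ * ‖g‖) : c ^ 2 * ‖f‖ ^ 2 ≤ ‖f + g‖ ^ 2 := by
  rw [@norm_add_sq ℂ]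
  have h1 := (abs_le.1 ((Complex.abs_re_le_norm (inner ℂ f g)).trans h)).1
  rw [RCLike.re_eq_complex_re]
  have : c ^ 2 = 1 - s ^ 2 := by linarith
  rw [this]
  nlinarith [sq_nonneg (s * ‖f‖ - ‖g‖)]

/-- Two subspaces with dense sum at a positive angle admit a bounded oblique projection. -/
theorem exists_projection_of_norm_le [CompleteSpace E] {H K : Submodule ℂ E} {C : ℝ} (hC : 0 ≤ C)
    (hd : Dense ((H ⊔ K : Submodule ℂ E) : Set E))
    (h : ∀ f ∈ H, ∀ g ∈ K, ‖f‖ ≤ C * ‖f + g‖) :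
    ∃ R : E →L[ℂ] E, (∀ f, R (R f) = R f) ∧
      LinearMap.range (R : E →ₗ[ℂ] E) = H.topologicalClosure ∧ (∀ g ∈ K, R g = 0) ∧ ‖R‖ ≤ C := by
  let e : (H × K) →ₗ[ℂ] E := H.subtype.coprod K.subtype
  let P : (H × K) →ₗ[ℂ] E := H.subtype ∘ₗ LinearMap.fst ℂ H K
  have hde : DenseRange e := by
    have : LinearMap.range e = H ⊔ K := by simp [e, LinearMap.range_coprod]
    rw [DenseRange, ← LinearMap.coe_range, this]
    exact hd
  have hb : ∀ x, ‖P x‖ ≤ C * ‖e x‖ := fun x => h _ x.1.2 _ x.2.2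
  -- The bound `hb` makes `f + g ↦ f` well defined and bounded on the dense sum, hence extendable to
  -- all of `E`.
  let R := P.extendOfNorm e
  have hR : ∀ x, R (e x) = P x := LinearMap.extendOfNorm_eq hde ⟨C, hb⟩
  have hRH : ∀ f ∈ H, R f = f := fun f hf => by simpa [e, P] using hR (⟨f, hf⟩, 0)
  have hRK : ∀ g ∈ K, R g = 0 := fun g hg => by simpa [e, P] using hR (0, ⟨g, hg⟩)
  have hfix : ∀ f ∈ H.topologicalClosure, R f = f := fun f hf =>
    closure_minimal (s := (H : Set E)) (t := {f | R f = f}) hRH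
      (isClosed_eq R.continuous continuous_id) hf
  have hmem : ∀ f, R f ∈ H.topologicalClosure := fun f => by
    refine hde.induction_on (p := fun f => R f ∈ H.topologicalClosure) f
      (H.isClosed_topologicalClosure.preimage R.continuous) fun x => ?_
    rw [hR]
    exact H.le_topologicalClosure x.1.2
  refine ⟨R, fun f => hfix _ (hmem f), le_antisymm ?_ fun f hf => ⟨f, hfix f hf⟩, hRK,
    LinearMap.opNorm_extendOfNorm_le hde hC hb⟩
  rintro _ ⟨f, rfl⟩
  exact hmem f

end AngleProjection

/-! ### Functionals on `L²` dominated by the `L¹` norm -/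

theorem MeasureTheory.Lp.integrable_of_two {α : Type*} [MeasurableSpace α] {μ : Measure α}
    [IsFiniteMeasure μ] (f : Lp ℂ 2 μ) : Integrable f μ :=
  (Lp.memLp f).integrable (by norm_num)

theorem MeasureTheory.Lp.integral_norm_le {α : Type*} [MeasurableSpace α] {μ : Measure α}
    [IsFiniteMeasure μ] (f : Lp ℂ 2 μ) :
    ∫ x, ‖f x‖ ∂μ ≤ (μ Set.univ ^ (1 / 2 : ℝ)).toReal * ‖f‖ := by
  have h := eLpNorm_le_eLpNorm_mul_rpow_measure_univ (p := 1) (q := 2) (by norm_num)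
    (Lp.aestronglyMeasurable f)
  rw [show 1 / (1 : ENNReal).toReal - 1 / (2 : ENNReal).toReal = (1 / 2 : ℝ) by norm_num] at h
  have hfin : μ Set.univ ^ (1 / 2 : ℝ) ≠ ⊤ :=
    ENNReal.rpow_ne_top_of_nonneg (by norm_num) (measure_ne_top _ _)
  have h2 := ENNReal.toReal_mono (ENNReal.mul_ne_top (Lp.eLpNorm_ne_top f) hfin) h
  rw [ENNReal.toReal_mul, ← Lp.norm_def] at h2
  rw [integral_norm_eq_lintegral_enorm (Lp.aestronglyMeasurable f), ← eLpNorm_one_eq_lintegral_enorm,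
    mul_comm]
  exact h2

/-- The seminorm `f ↦ s ∫ |f| dμ` on `L²(μ)`. -/
noncomputable def l1Seminorm {α : Type*} [MeasurableSpace α] (μ : Measure α) [IsFiniteMeasure μ]
    {s : ℝ} (hs : 0 ≤ s) : Seminorm ℂ (Lp ℂ 2 μ) :=
  Seminorm.of (fun f => s * ∫ x, ‖f x‖ ∂μ)
    (fun f g => by
      rw [← mul_add, ← integral_add (Lp.integrable_of_two f).norm (Lp.integrable_of_two g).norm]
      refine mul_le_mul_of_nonneg_left (integral_mono_ae (Lp.integrable_of_two (f + g)).norm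
        ((Lp.integrable_of_two f).norm.add (Lp.integrable_of_two g).norm) ?_) hs
      filter_upwards [Lp.coeFn_add f g] with x hx
      rw [hx]
      exact norm_add_le _ _)
    (fun a f => by
      have : ∫ x, ‖(a • f : Lp ℂ 2 μ) x‖ ∂μ = ∫ x, ‖a‖ * ‖f x‖ ∂μ := integral_congr_ae (by
        filter_upwards [Lp.coeFn_smul a f] with x hx
        rw [hx, Pi.smul_apply, norm_smul])
      rw [this, integral_const_mul]; ring)

theorem l1Seminorm_apply {α : Type*} [MeasurableSpace α] {μ : Measure α} [IsFiniteMeasure μ]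
    {s : ℝ} (hs : 0 ≤ s) (f : Lp ℂ 2 μ) : l1Seminorm μ hs f = s * ∫ x, ‖f x‖ ∂μ := rfl

theorem continuous_l1Seminorm {α : Type*} [MeasurableSpace α] {μ : Measure α} [IsFiniteMeasure μ]
    {s : ℝ} (hs : 0 ≤ s) : Continuous (l1Seminorm μ hs) := by
  refine Seminorm.continuous_of_le (q := (⟨s, hs⟩ * (μ Set.univ ^ (1 / 2 : ℝ)).toNNReal : NNReal) •
    normSeminorm ℂ (Lp ℂ 2 μ)) ?_ fun f => ?_
  · exact continuous_norm.const_smul _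
  · rw [l1Seminorm_apply]
    change _ ≤ s * (μ Set.univ ^ (1 / 2 : ℝ)).toReal * ‖f‖
    rw [mul_assoc]
    exact mul_le_mul_of_nonneg_left (Lp.integral_norm_le f) hs

/-- A square integrable function whose pairings are bounded by `s` times the `L¹` norm is bounded
by `s` almost everywhere. -/
theorem ae_norm_le_of_norm_inner_le {α : Type*} [MeasurableSpace α] {μ : Measure α}
    [IsFiniteMeasure μ] {s : ℝ} (hs : 0 ≤ s) (v : Lp ℂ 2 μ)
    (h : ∀ f : Lp ℂ 2 μ, ‖inner ℂ v f‖ ≤ s * ∫ x, ‖f x‖ ∂μ) : ∀ᵐ x ∂μ, ‖v x‖ ≤ s := by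
  refine ae_le_of_forall_setIntegral_le (Lp.integrable_of_two v).norm (integrable_const s)
    fun S hS _ => ?_
  -- The test function is `v / |v|` on `S`, set to `0` where `v` vanishes by the convention `0⁻¹ =
  -- 0`. Its pairing with `v` is `∫_S |v|`.
  have hm : StronglyMeasurable (S.indicator fun x => v x * ((‖v x‖⁻¹ : ℝ) : ℂ)) :=
    ((Lp.stronglyMeasurable v).mul
      (Complex.measurable_ofReal.comp
        (Lp.stronglyMeasurable v).norm.measurable.inv).stronglyMeasurable).indicator hS
  have hbd : ∀ x, ‖v x * ((‖v x‖⁻¹ : ℝ) : ℂ)‖ ≤ 1 := fun x => by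
    rw [norm_mul, Complex.norm_real, norm_inv, norm_norm]
    exact mul_inv_le_one
  have hL : MemLp (S.indicator fun x => v x * ((‖v x‖⁻¹ : ℝ) : ℂ)) 2 μ :=
    MemLp.of_bound hm.aestronglyMeasurable 1 (Filter.Eventually.of_forall fun x =>
      (norm_indicator_le_norm_self _ _).trans (hbd x))
  have h1 : inner ℂ v (hL.toLp _) = ((∫ x in S, ‖v x‖ ∂μ : ℝ) : ℂ) := by
    rw [L2.inner_def, ← integral_indicator hS, ← integral_complex_ofReal]
    refine integral_congr_ae ?_
    filter_upwards [hL.coeFn_toLp] with x hx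
    rw [hx]
    by_cases hxS : x ∈ S
    · rw [Set.indicator_of_mem hxS, Set.indicator_of_mem hxS, RCLike.inner_apply,
        mul_right_comm, Complex.mul_conj, Complex.normSq_eq_norm_sq, ← Complex.ofReal_mul]
      rcases eq_or_ne ‖v x‖ 0 with h0 | h0
      · simp [h0]
      · field_simp
    · simp [Set.indicator_of_notMem hxS]
  have h2 : ∫ x, ‖hL.toLp _ x‖ ∂μ ≤ ∫ x in S, (1 : ℝ) ∂μ := by
    rw [← integral_indicator hS]
    refine integral_mono_ae (Lp.integrable_of_two (hL.toLp _)).norm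
      ((integrable_const 1).indicator hS) ?_
    filter_upwards [hL.coeFn_toLp] with x hx
    rw [hx, norm_indicator_eq_indicator_norm]
    exact Set.indicator_le_indicator (hbd x)
  have h3 := h (hL.toLp _)
  rw [h1, Complex.norm_real] at h3
  refine (Real.le_norm_self _).trans (h3.trans ?_)
  refine (mul_le_mul_of_nonneg_left h2 hs).trans_eq ?_
  rw [← integral_const_mul, mul_one]

/-- A functional on a subspace of `L²(μ)` bounded by `s` times the `L¹` norm is integration against
a function bounded by `s`. -/
theorem exists_bounded_density {α : Type*} [MeasurableSpace α] {μ : Measure α}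
    [IsFiniteMeasure μ] {s : ℝ} (hs : 0 ≤ s) (V : Submodule ℂ (Lp ℂ 2 μ))
    (T : Lp ℂ 2 μ →ₗ[ℂ] ℂ) (h : ∀ f ∈ V, ‖T f‖ ≤ s * ∫ x, ‖f x‖ ∂μ) :
    ∃ ψ : α → ℂ, StronglyMeasurable ψ ∧ (∀ᵐ x ∂μ, ‖ψ x‖ ≤ s) ∧
      ∀ f ∈ V, T f = ∫ x, ψ x * f x ∂μ := by
  -- The extension keeps the `L¹` bound but lives on `L²`, so the Hilbert space representation
  -- yields its density `v`; the `L¹` bound then forces `|v| ≤ s`.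
  obtain ⟨g, hg1, hg2⟩ := Module.Dual.exists_continuous_extension_of_le_seminorm V
    (T ∘ₗ V.subtype) (continuous_l1Seminorm (μ := μ) hs) (fun f => h f f.2)
  set v : Lp ℂ 2 μ := (InnerProductSpace.toDual ℂ _).symm g
  have hv : ∀ f, inner ℂ v f = g f := fun f => InnerProductSpace.toDual_symm_apply
  have hb := ae_norm_le_of_norm_inner_le hs v fun f => by rw [hv]; exact hg2 f
  refine ⟨fun x => (starRingEnd ℂ) (v x),
    Complex.continuous_conj.comp_stronglyMeasurable (Lp.stronglyMeasurable v), ?_, fun f hf => ?_⟩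
  · simpa using hb
  · have := hg1 ⟨f, hf⟩
    rw [← hv, L2.inner_def] at this
    simpa [RCLike.inner_apply, mul_comm] using this.symm

/-! ### Polynomials on the circle and the bilinear form -/

open scoped ComplexConjugate

/-- The function `p(e^{iθ})` on the circle. -/
noncomputable def circlePolynomial : Polynomial ℂ →ₐ[ℂ] C(AddCircle (2 * Real.pi), ℂ) :=
  Polynomial.aeval (fourier 1)

theorem circlePolynomial_apply (p : Polynomial ℂ) (t : AddCircle (2 * Real.pi)) :
    circlePolynomial p t = p.eval (fourier 1 t) := by
  change ContinuousMap.evalAlgHom ℂ ℂ t (Polynomial.aeval (fourier 1) p) = _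
  rw [← Polynomial.aeval_algHom_apply, Polynomial.coe_aeval_eq_eval]
  rfl

theorem norm_fourier_apply (n : ℤ) (t : AddCircle (2 * Real.pi)) : ‖fourier n t‖ = 1 :=
  Circle.norm_coe _

theorem fourier_one_pow (n : ℕ) :
    (fourier 1 : C(AddCircle (2 * Real.pi), ℂ)) ^ n = fourier (n : ℤ) := by
  induction n with
  | zero => ext t; simp
  | succ n ih =>
    ext t
    rw [pow_succ, ih, Nat.cast_succ, ContinuousMap.mul_apply, fourier_add]

theorem circlePolynomial_X_pow (n : ℕ) : circlePolynomial (Polynomial.X ^ n) = fourier (n : ℤ) := by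
  rw [circlePolynomial, map_pow, Polynomial.aeval_X, fourier_one_pow]

/-- Both sides are continuous in `(f, g)`. This carries the angle bound from polynomials to the disc
algebra. -/
theorem norm_inner_le_of_mem_closure {X E : Type*} [TopologicalSpace X] [NormedAddCommGroup E]
    [InnerProductSpace ℂ E] {S : Set X} {u v : X → E} (hu : Continuous u) (hv : Continuous v)
    {s : ℝ} (h : ∀ f ∈ S, ∀ g ∈ S, ‖inner ℂ (v g) (u f)‖ ≤ s * ‖u f‖ * ‖v g‖) :
    ∀ f ∈ closure S, ∀ g ∈ closure S, ‖inner ℂ (v g) (u f)‖ ≤ s * ‖u f‖ * ‖v g‖ := by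
  intro f hf g hg
  have hcl : IsClosed {x : X × X | ‖inner ℂ (v x.2) (u x.1)‖ ≤ s * ‖u x.1‖ * ‖v x.2‖} :=
    isClosed_le (by fun_prop) (by fun_prop)
  have hmem : (f, g) ∈ closure (S ×ˢ S) := by
    rw [closure_prod_eq]; exact ⟨hf, hg⟩
  exact closure_minimal (fun x hx => h x.1 hx.1 x.2 hx.2) hcl hmem

section FiniteMeasure

variable (μ : Measure (AddCircle (2 * Real.pi))) [IsFiniteMeasure μ]

theorem norm_sq_toLp (f : C(AddCircle (2 * Real.pi), ℂ)) :
    ‖ContinuousMap.toLp (E := ℂ) 2 μ ℂ f‖ ^ 2 = ∫ t, ‖f t‖ ^ 2 ∂μ := by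
  have h : ∀ t, f t * conj (f t) = ((‖f t‖ ^ 2 : ℝ) : ℂ) := fun t => by
    rw [Complex.mul_conj, Complex.normSq_eq_norm_sq]
  rw [← inner_self_eq_norm_sq (𝕜 := ℂ), ContinuousMap.inner_toLp]
  simp only [h]
  rw [integral_complex_ofReal]
  rfl

theorem norm_toLp_congr {f g : C(AddCircle (2 * Real.pi), ℂ)} (h : ∀ t, ‖f t‖ = ‖g t‖) :
    ‖ContinuousMap.toLp (E := ℂ) 2 μ ℂ f‖ = ‖ContinuousMap.toLp (E := ℂ) 2 μ ℂ g‖ := by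
  rw [← sq_eq_sq₀ (norm_nonneg _) (norm_nonneg _), norm_sq_toLp, norm_sq_toLp]
  simp only [h]

theorem integral_norm_mul_norm_le (f g : C(AddCircle (2 * Real.pi), ℂ)) :
    ∫ t, ‖f t‖ * ‖g t‖ ∂μ ≤
      ‖ContinuousMap.toLp (E := ℂ) 2 μ ℂ f‖ * ‖ContinuousMap.toLp (E := ℂ) 2 μ ℂ g‖ := by
  let a : C(AddCircle (2 * Real.pi), ℂ) → C(AddCircle (2 * Real.pi), ℂ) :=
    fun f => ⟨fun t => (‖f t‖ : ℂ), by fun_prop⟩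
  have ha : ∀ f, ‖ContinuousMap.toLp (E := ℂ) 2 μ ℂ (a f)‖ = ‖ContinuousMap.toLp (E := ℂ) 2 μ ℂ f‖ :=
    fun f => norm_toLp_congr μ fun t => by simp [a]
  have h := norm_inner_le_norm (𝕜 := ℂ) (ContinuousMap.toLp (E := ℂ) 2 μ ℂ (a g))
    (ContinuousMap.toLp (E := ℂ) 2 μ ℂ (a f))
  rw [ContinuousMap.inner_toLp, ha, ha] at h
  have h2 : ∀ t, a f t * conj (a g t) = ((‖f t‖ * ‖g t‖ : ℝ) : ℂ) := fun t => by simp [a]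
  simp only [h2] at h
  rw [integral_complex_ofReal, Complex.norm_real] at h
  exact (Real.le_norm_self _).trans (h.trans_eq (mul_comm _ _))

/-- The bilinear form `∫ f g e^{iθ} dμ` as an inner product. -/
theorem inner_toLp_star_fourier_mul (f g : C(AddCircle (2 * Real.pi), ℂ)) :
    inner ℂ (ContinuousMap.toLp (E := ℂ) 2 μ ℂ (star (fourier 1 * g)))
      (ContinuousMap.toLp (E := ℂ) 2 μ ℂ f) = ∫ t, fourier 1 t * (f t * g t) ∂μ := by
  rw [ContinuousMap.inner_toLp]
  refine integral_congr_ae (Filter.Eventually.of_forall fun t => ?_)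
  simp only [ContinuousMap.star_apply, RCLike.star_def, Complex.conj_conj, ContinuousMap.mul_apply]
  ring

/-- Restriction to the circle of a function of the disc algebra. -/
theorem exists_mem_closure_circlePolynomial {f : ℂ → ℂ} (hf : DiffContOnCl ℂ f (Metric.ball 0 1)) :
    ∃ F ∈ closure (Set.range circlePolynomial), ∀ t, F t = f (fourier 1 t) := by
  have hc : Continuous fun t : AddCircle (2 * Real.pi) => f (fourier 1 t) :=
    hf.continuousOn_ball.comp_continuous (fourier 1).continuous fun t => by
      rw [mem_closedBall_zero_iff, norm_fourier_apply]
  refine ⟨⟨_, hc⟩, Metric.mem_closure_iff.2 fun ε hε => ?_, fun t => rfl⟩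
  obtain ⟨p, hp⟩ := hf.exists_polynomial_near hε
  refine ⟨_, ⟨p, rfl⟩, ?_⟩
  rw [dist_comm, ContinuousMap.dist_lt_iff hε]
  intro t
  rw [dist_eq_norm, circlePolynomial_apply]
  exact hp _ (norm_fourier_apply 1 t).le

/-- A bound for the bilinear form `∫ p q e^{iθ} dμ` by the `L²` norms gives a bound for the linear
form `∫ p e^{iθ} dμ` by the `L¹` norm. -/
theorem norm_integral_circlePolynomial_le {s : ℝ}
    (h : ∀ p q : Polynomial ℂ,
      ‖inner ℂ (ContinuousMap.toLp (E := ℂ) 2 μ ℂ (star (fourier 1 * circlePolynomial q)))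
        (ContinuousMap.toLp (E := ℂ) 2 μ ℂ (circlePolynomial p))‖ ≤
      s * ‖ContinuousMap.toLp (E := ℂ) 2 μ ℂ (circlePolynomial p)‖ *
        ‖ContinuousMap.toLp (E := ℂ) 2 μ ℂ (star (fourier 1 * circlePolynomial q))‖)
    (p : Polynomial ℂ) :
    ‖∫ t, fourier 1 t * circlePolynomial p t ∂μ‖ ≤ s * ∫ t, ‖circlePolynomial p t‖ ∂μ := by
  have hext : ∀ f ∈ closure (Set.range circlePolynomial),
      ∀ g ∈ closure (Set.range circlePolynomial),
      ‖inner ℂ (ContinuousMap.toLp (E := ℂ) 2 μ ℂ (star (fourier 1 * g)))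
        (ContinuousMap.toLp (E := ℂ) 2 μ ℂ f)‖ ≤
      s * ‖ContinuousMap.toLp (E := ℂ) 2 μ ℂ f‖ *
        ‖ContinuousMap.toLp (E := ℂ) 2 μ ℂ (star (fourier 1 * g))‖ := by
    refine norm_inner_le_of_mem_closure (ContinuousLinearMap.continuous _)
      ((ContinuousLinearMap.continuous _).comp (by fun_prop)) ?_
    rintro _ ⟨p, rfl⟩ _ ⟨q, rfl⟩
    exact h p q
  obtain ⟨f, g, hf, hg, hfg⟩ := p.hasBalancedFactorization
  obtain ⟨F, hF, hFf⟩ := exists_mem_closure_circlePolynomial hf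
  obtain ⟨G, hG, hGg⟩ := exists_mem_closure_circlePolynomial hg
  have hz := fun t => hfg _ (norm_fourier_apply 1 t)
  simp only [← circlePolynomial_apply, ← hFf, ← hGg] at hz
  -- Since `|F|² = |G|² = |p|` on the circle, both `L²` norms are equal and their product is `∫ |p|
  -- dμ`.
  have key := hext F hF G hG
  have hstar : ‖ContinuousMap.toLp (E := ℂ) 2 μ ℂ (star (fourier 1 * G))‖ =
      ‖ContinuousMap.toLp (E := ℂ) 2 μ ℂ F‖ := norm_toLp_congr μ fun t => by
    rw [ContinuousMap.star_apply, norm_star, ContinuousMap.mul_apply, norm_mul,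
      norm_fourier_apply, one_mul, ← sq_eq_sq₀ (norm_nonneg _) (norm_nonneg _), (hz t).2.1,
      (hz t).2.2]
  rw [inner_toLp_star_fourier_mul, hstar, mul_assoc, ← pow_two, norm_sq_toLp] at key
  simpa only [← (hz _).1, (hz _).2.1] using key

end FiniteMeasure

/-! ### The Riesz projection as an angle condition in `L²(w)` -/

namespace IsWeight

variable {w : AddCircle (2 * Real.pi) → ℝ}

theorem aemeasurable_ofReal (hw : IsWeight w) :
    AEMeasurable (fun t => ENNReal.ofReal (w t)) haarAddCircle :=
  hw.integrable.aestronglyMeasurable.aemeasurable.ennreal_ofReal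

theorem integral_weightMeasure (hw : IsWeight w) {F : Type*} [NormedAddCommGroup F]
    [NormedSpace ℝ F] (f : AddCircle (2 * Real.pi) → F) :
    ∫ t, f t ∂(weightMeasure w) = ∫ t, w t • f t ∂haarAddCircle := by
  rw [weightMeasure, integral_withDensity_eq_integral_toReal_smul₀ hw.aemeasurable_ofReal
    (Filter.Eventually.of_forall fun _ => ENNReal.ofReal_lt_top)]
  refine integral_congr_ae ?_
  filter_upwards [hw.nonneg] with t ht
  rw [ENNReal.toReal_ofReal ht]

/-- The trigonometric polynomials with frequencies `n ≥ 0` in `L²(w)`. -/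
noncomputable def analyticSpan (hw : IsWeight w) : Submodule ℂ (WeightedL2 w) :=
  Submodule.span ℂ {f | ∃ n : ℤ, 0 ≤ n ∧ f = hw.exponential n}

/-- The trigonometric polynomials with frequencies `n < 0` in `L²(w)`. -/
noncomputable def antianalyticSpan (hw : IsWeight w) : Submodule ℂ (WeightedL2 w) :=
  Submodule.span ℂ {f | ∃ n : ℤ, n < 0 ∧ f = hw.exponential n}

theorem mem_analyticSpan_iff (hw : IsWeight w) {f : WeightedL2 w} :
    haveI := hw.isFiniteMeasure
    f ∈ hw.analyticSpan ↔
      ∃ p, ContinuousMap.toLp (E := ℂ) 2 (weightMeasure w) ℂ (circlePolynomial p) = f := by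
  have := hw.isFiniteMeasure
  constructor
  · intro hf
    induction hf using Submodule.span_induction with
    | mem x hx =>
      obtain ⟨n, hn, rfl⟩ := hx
      lift n to ℕ using hn
      exact ⟨Polynomial.X ^ n, by rw [circlePolynomial_X_pow]; rfl⟩
    | zero => exact ⟨0, by simp⟩
    | add x y _ _ hx hy =>
      obtain ⟨p, rfl⟩ := hx
      obtain ⟨q, rfl⟩ := hy
      exact ⟨p + q, by simp⟩
    | smul a x _ hx =>
      obtain ⟨p, rfl⟩ := hx
      exact ⟨a • p, by simp⟩
  · rintro ⟨p, rfl⟩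
    induction p using Polynomial.induction_on' with
    | add p q hp hq => simpa using add_mem hp hq
    | monomial n a =>
      rw [← Polynomial.C_mul_X_pow_eq_monomial, ← Polynomial.smul_eq_C_mul, map_smul, map_smul,
        circlePolynomial_X_pow]
      exact Submodule.smul_mem _ _ (Submodule.subset_span ⟨n, Int.natCast_nonneg n, rfl⟩)

theorem star_fourier_one_mul (n : ℕ) :
    star (fourier 1 * fourier (n : ℤ) : C(AddCircle (2 * Real.pi), ℂ)) = fourier (-(n + 1 : ℤ)) := by
  ext t
  rw [fourier_neg, ContinuousMap.star_apply, add_comm, fourier_add, ContinuousMap.mul_apply]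
  rfl

/-- The factor `e^{iθ}` supplies the shift by one: conjugating `e^{iθ} e^{ikθ}`, `k ≥ 0`, gives
exactly the frequencies `-(k + 1) < 0`. -/
theorem mem_antianalyticSpan_iff (hw : IsWeight w) {f : WeightedL2 w} :
    haveI := hw.isFiniteMeasure
    f ∈ hw.antianalyticSpan ↔
      ∃ p, ContinuousMap.toLp (E := ℂ) 2 (weightMeasure w) ℂ
        (star (fourier 1 * circlePolynomial p)) = f := by
  have := hw.isFiniteMeasure
  constructor
  · intro hf
    induction hf using Submodule.span_induction with
    | mem x hx =>
      obtain ⟨n, hn, rfl⟩ := hx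
      obtain ⟨k, rfl⟩ : ∃ k : ℕ, n = -(k + 1 : ℤ) := ⟨(-n - 1).toNat, by omega⟩
      exact ⟨Polynomial.X ^ k, by rw [circlePolynomial_X_pow, star_fourier_one_mul]; rfl⟩
    | zero => exact ⟨0, by simp⟩
    | add x y _ _ hx hy =>
      obtain ⟨p, rfl⟩ := hx
      obtain ⟨q, rfl⟩ := hy
      exact ⟨p + q, by rw [map_add, mul_add, star_add, map_add]⟩
    | smul a x _ hx =>
      obtain ⟨p, rfl⟩ := hx
      exact ⟨conj a • p, by rw [map_smul, mul_smul_comm, star_smul, map_smul]; simp⟩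
  · rintro ⟨p, rfl⟩
    induction p using Polynomial.induction_on' with
    | add p q hp hq =>
      rw [map_add, mul_add, star_add, map_add]
      exact add_mem hp hq
    | monomial n a =>
      rw [← Polynomial.C_mul_X_pow_eq_monomial, ← Polynomial.smul_eq_C_mul, map_smul,
        mul_smul_comm, star_smul, map_smul, circlePolynomial_X_pow, star_fourier_one_mul]
      exact Submodule.smul_mem _ _ (Submodule.subset_span ⟨_, by omega, rfl⟩)

theorem dense_analyticSpan_sup (hw : IsWeight w) :
    Dense ((hw.analyticSpan ⊔ hw.antianalyticSpan : Submodule ℂ (WeightedL2 w)) :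
      Set (WeightedL2 w)) := by
  refine (Submodule.dense_iff_topologicalClosure_eq_top.2 hw.span_exponential).mono ?_
  refine Submodule.span_le.2 ?_
  rintro _ ⟨n, rfl⟩
  rcases lt_or_ge n 0 with hn | hn
  · exact Submodule.mem_sup_right (Submodule.subset_span ⟨n, hn, rfl⟩)
  · exact Submodule.mem_sup_left (Submodule.subset_span ⟨n, hn, rfl⟩)

/-- The Riesz projection is bounded by `1 / c` exactly when the cosine of the angle between the
analytic and the antianalytic trigonometric polynomials is at most `s`, where `s² + c² = 1`. -/
theorem isA2_and_norm_le_iff (hw : IsWeight w) {s c : ℝ} (hs : 0 ≤ s) (hc : 0 < c)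
    (hsc : s ^ 2 + c ^ 2 = 1) :
    (hw.IsA2 ∧ ‖hw.rieszProjection‖ ≤ 1 / c) ↔
      ∀ f ∈ hw.analyticSpan, ∀ g ∈ hw.antianalyticSpan, ‖inner ℂ f g‖ ≤ s * ‖f‖ * ‖g‖ := by
  constructor
  · rintro ⟨hA, hn⟩
    have hR := hA.isRieszProjection
    refine norm_inner_le_of_norm_le_norm_add hs hsc fun f hf g hg => ?_
    have hf' : hw.rieszProjection f = f := by
      have hmem : f ∈ hw.hardyTwo := Submodule.le_topologicalClosure _ hf
      rw [← hR.range_eq] at hmem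
      obtain ⟨x, rfl⟩ := hmem
      exact hR.idempotent x
    have hg' : hw.rieszProjection g = 0 := by
      have hle : hw.antianalyticSpan ≤ LinearMap.ker hw.rieszProjection.toLinearMap := by
        refine Submodule.span_le.2 ?_
        rintro _ ⟨n, hn, rfl⟩
        exact hR.map_exponential n hn
      exact hle hg
    have h1 := hw.rieszProjection.le_of_opNorm_le hn (f + g)
    rw [map_add, hf', hg', add_zero, one_div, inv_mul_eq_div, le_div_iff₀ hc] at h1
    rw [← mul_pow]
    exact pow_le_pow_left₀ (by positivity) (by rwa [mul_comm]) 2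
  · intro h
    obtain ⟨R, hR1, hR2, hR3, hR4⟩ := exists_projection_of_norm_le (C := 1 / c) (by positivity)
      hw.dense_analyticSpan_sup fun f hf g hg => by
        have h1 := norm_le_norm_add_of_norm_inner_le hsc (h f hf g hg)
        rw [← mul_pow, sq_le_sq₀ (by positivity) (norm_nonneg _)] at h1
        rw [one_div, inv_mul_eq_div, le_div_iff₀ hc, mul_comm]
        exact h1
    have hRR : hw.IsRieszProjection R :=
      ⟨hR1, hR2, fun n hn => hR3 _ (Submodule.subset_span ⟨n, hn, rfl⟩)⟩
    have hA : hw.IsA2 := ⟨R, hRR⟩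
    exact ⟨hA, by rwa [hA.isRieszProjection.unique hRR]⟩

/-- The bound on the Riesz projection as a bound on the bilinear form `∫ p q e^{iθ} w dθ` over
polynomials. -/
theorem isA2_and_norm_le_iff_polynomial (hw : IsWeight w) {s c : ℝ} (hs : 0 ≤ s) (hc : 0 < c)
    (hsc : s ^ 2 + c ^ 2 = 1) :
    haveI := hw.isFiniteMeasure
    (hw.IsA2 ∧ ‖hw.rieszProjection‖ ≤ 1 / c) ↔ ∀ p q : Polynomial ℂ,
      ‖inner ℂ (ContinuousMap.toLp (E := ℂ) 2 (weightMeasure w) ℂ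
          (star (fourier 1 * circlePolynomial q)))
        (ContinuousMap.toLp (E := ℂ) 2 (weightMeasure w) ℂ (circlePolynomial p))‖ ≤
      s * ‖ContinuousMap.toLp (E := ℂ) 2 (weightMeasure w) ℂ (circlePolynomial p)‖ *
        ‖ContinuousMap.toLp (E := ℂ) 2 (weightMeasure w) ℂ
          (star (fourier 1 * circlePolynomial q))‖ := by
  rw [hw.isA2_and_norm_le_iff hs hc hsc]
  simp only [mem_analyticSpan_iff, mem_antianalyticSpan_iff, forall_exists_index,
    forall_apply_eq_imp_iff]
  refine forall_congr' fun p => forall_congr' fun q => ?_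
  rw [norm_inner_symm]

end IsWeight

/-! ### From `h` to the bilinear bound and back -/

/-- On the monomial `z^n` the integral is the Fourier coefficient of `h` of index `-(n + 1)`. -/
theorem MemHardyOne.integral_eq_zero {h : AddCircle (2 * Real.pi) → ℂ} (hh : MemHardyOne h)
    (p : Polynomial ℂ) :
    ∫ t, fourier 1 t * circlePolynomial p t * h t ∂haarAddCircle = 0 := by
  have hint : ∀ f : C(AddCircle (2 * Real.pi), ℂ),
      Integrable (fun t => f t * h t) haarAddCircle := fun f =>
    hh.integrable.bdd_mul f.continuous.aestronglyMeasurable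
      (Filter.Eventually.of_forall f.norm_coe_le_norm)
  induction p using Polynomial.induction_on' with
  | add p q hp hq =>
    simp only [map_add, ContinuousMap.add_apply, mul_add, add_mul]
    refine (integral_add (hint (fourier 1 * circlePolynomial p))
      (hint (fourier 1 * circlePolynomial q))).trans ?_
    exact (congrArg₂ (· + ·) hp hq).trans (add_zero 0)
  | monomial n a =>
    have h1 := hh.fourierCoeff_eq_zero (-(n + 1 : ℤ)) (by omega)
    rw [fourierCoeff, neg_neg] at h1
    rw [← Polynomial.C_mul_X_pow_eq_monomial, ← Polynomial.smul_eq_C_mul, map_smul,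
      circlePolynomial_X_pow, ← mul_zero a, ← h1, ← integral_const_mul]
    refine integral_congr_ae (Filter.Eventually.of_forall fun t => ?_)
    simp only [ContinuousMap.smul_apply, smul_eq_mul, add_comm (n : ℤ) 1]
    rw [fourier_add]
    ring

/-- The form does not see `h`, so its density `w` can be replaced by `w - h`, which is at most `s w`
in modulus; Cauchy–Schwarz in `L²(w)` finishes. -/
theorem IsWeight.norm_inner_le_of_memHardyOne {w : AddCircle (2 * Real.pi) → ℝ} (hw : IsWeight w)
    {s : ℝ} (hs : 0 ≤ s) {h : AddCircle (2 * Real.pi) → ℂ} (hh : MemHardyOne h)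
    (hle : ∀ᵐ t ∂haarAddCircle, ‖(w t : ℂ) - h t‖ ≤ w t * s) (p q : Polynomial ℂ) :
    haveI := hw.isFiniteMeasure
    ‖inner ℂ (ContinuousMap.toLp (E := ℂ) 2 (weightMeasure w) ℂ
          (star (fourier 1 * circlePolynomial q)))
        (ContinuousMap.toLp (E := ℂ) 2 (weightMeasure w) ℂ (circlePolynomial p))‖ ≤
      s * ‖ContinuousMap.toLp (E := ℂ) 2 (weightMeasure w) ℂ (circlePolynomial p)‖ *
        ‖ContinuousMap.toLp (E := ℂ) 2 (weightMeasure w) ℂ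
          (star (fourier 1 * circlePolynomial q))‖ := by
  have := hw.isFiniteMeasure
  set F : C(AddCircle (2 * Real.pi), ℂ) := fourier 1 * circlePolynomial (p * q) with hF
  have hint : ∀ {k : AddCircle (2 * Real.pi) → ℂ}, Integrable k haarAddCircle →
      Integrable (fun t => F t * k t) haarAddCircle := fun hk =>
    hk.bdd_mul F.continuous.aestronglyMeasurable (Filter.Eventually.of_forall F.norm_coe_le_norm)
  have hFn : ∀ t, ‖F t‖ = ‖circlePolynomial p t‖ * ‖circlePolynomial q t‖ := fun t => by
    simp only [hF, map_mul, ContinuousMap.mul_apply, norm_mul, norm_fourier_apply, one_mul]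
  have hwc : Integrable (fun t => (w t : ℂ)) haarAddCircle := hw.integrable.ofReal
  have h1 : ∫ t, fourier 1 t * (circlePolynomial p t * circlePolynomial q t) ∂(weightMeasure w) =
      ∫ t, F t * ((w t : ℂ) - h t) ∂haarAddCircle := by
    have h0 := hh.integral_eq_zero (p * q)
    simp only [mul_sub]
    rw [integral_sub (hint hwc) (hint hh.integrable)]
    change _ = _ - ∫ t, fourier 1 t * circlePolynomial (p * q) t * h t ∂haarAddCircle
    rw [h0, sub_zero, hw.integral_weightMeasure]
    refine integral_congr_ae (Filter.Eventually.of_forall fun t => ?_)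
    simp only [hF, map_mul, ContinuousMap.mul_apply, Complex.real_smul]
    ring
  have h2 : ‖∫ t, F t * ((w t : ℂ) - h t) ∂haarAddCircle‖ ≤
      s * ∫ t, ‖circlePolynomial p t‖ * ‖circlePolynomial q t‖ ∂(weightMeasure w) := by
    rw [hw.integral_weightMeasure, ← integral_const_mul]
    refine norm_integral_le_of_norm_le ?_ ?_
    · refine (((hint hwc).norm.const_mul s).congr ?_)
      filter_upwards [hw.nonneg] with t ht
      rw [norm_mul, hFn, Complex.norm_real, Real.norm_of_nonneg ht, smul_eq_mul]
      ring
    · filter_upwards [hle] with t ht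
      rw [norm_mul, hFn, smul_eq_mul]
      refine (mul_le_mul_of_nonneg_left ht (by positivity)).trans_eq ?_
      ring
  rw [inner_toLp_star_fourier_mul, h1, mul_assoc]
  refine h2.trans (mul_le_mul_of_nonneg_left ?_ hs)
  refine (integral_norm_mul_norm_le _ _ _).trans_eq ?_
  congr 1
  refine norm_toLp_congr _ fun t => ?_
  rw [ContinuousMap.star_apply, norm_star, ContinuousMap.mul_apply, norm_mul, norm_fourier_apply,
    one_mul]

/-- A density `ψ` that represents `p ↦ ∫ e^{iθ} p w` makes `(e^{iθ} - ψ) w` orthogonal to all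
`e^{ikθ}`, `k ≥ 0`. Multiplying by `e^{-iθ}` turns this into the vanishing of the negative
coefficients of `h`. -/
theorem IsWeight.exists_memHardyOne {w : AddCircle (2 * Real.pi) → ℝ} (hw : IsWeight w)
    {s : ℝ} (hs : 0 ≤ s)
    (H : ∀ p : Polynomial ℂ, ‖∫ t, fourier 1 t * circlePolynomial p t ∂(weightMeasure w)‖ ≤
      s * ∫ t, ‖circlePolynomial p t‖ ∂(weightMeasure w)) :
    ∃ h : AddCircle (2 * Real.pi) → ℂ, MemHardyOne h ∧
      ∀ᵐ t ∂haarAddCircle, ‖(w t : ℂ) - h t‖ ≤ w t * s := by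
  have := hw.isFiniteMeasure
  have hT : ∀ p : Polynomial ℂ, inner ℂ (ContinuousMap.toLp (E := ℂ) 2 (weightMeasure w) ℂ
      (star (fourier 1 * 1))) (ContinuousMap.toLp (E := ℂ) 2 (weightMeasure w) ℂ
        (circlePolynomial p)) = ∫ t, fourier 1 t * circlePolynomial p t ∂(weightMeasure w) :=
    fun p => by rw [inner_toLp_star_fourier_mul]; simp only [ContinuousMap.one_apply, mul_one]
  obtain ⟨ψ, hψm, hψs, hψ⟩ := exists_bounded_density hs hw.analyticSpan
    (innerSL ℂ (ContinuousMap.toLp (E := ℂ) 2 (weightMeasure w) ℂ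
      (star (fourier 1 * 1)))).toLinearMap (by
    intro f hf
    obtain ⟨p, rfl⟩ := hw.mem_analyticSpan_iff.1 hf
    refine (congrArg norm (hT p)).trans_le ((H p).trans_eq ?_)
    congr 1
    refine integral_congr_ae ?_
    filter_upwards [ContinuousMap.coeFn_toLp (p := 2) (𝕜 := ℂ) (weightMeasure w)
      (circlePolynomial p)] with t ht
    rw [ht])
  have hψ' : ∀ p : Polynomial ℂ, ∫ t, fourier 1 t * circlePolynomial p t ∂(weightMeasure w) =
      ∫ t, ψ t * circlePolynomial p t ∂(weightMeasure w) := fun p => by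
    rw [← hT]
    refine (hψ _ (hw.mem_analyticSpan_iff.2 ⟨p, rfl⟩)).trans (integral_congr_ae ?_)
    filter_upwards [ContinuousMap.coeFn_toLp (p := 2) (𝕜 := ℂ) (weightMeasure w)
      (circlePolynomial p)] with t ht
    rw [ht]
  have hψw : ∀ᵐ t ∂haarAddCircle, ‖fourier (-1) t * ψ t * (w t : ℂ)‖ ≤ w t * s := by
    rw [weightMeasure, ae_withDensity_iff' hw.aemeasurable_ofReal] at hψs
    filter_upwards [hψs, hw.nonneg] with t ht hwt
    rw [norm_mul, norm_mul, norm_fourier_apply, one_mul, Complex.norm_real,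
      Real.norm_of_nonneg hwt, mul_comm]
    -- The bound on `ψ` is known only where `w > 0`; where `w = 0` both sides vanish.
    rcases hwt.eq_or_lt with h0 | h0
    · rw [← h0, zero_mul, zero_mul]
    · exact mul_le_mul_of_nonneg_left (ht (by simpa using h0)) hwt
  have hwc : Integrable (fun t => (w t : ℂ)) haarAddCircle := hw.integrable.ofReal
  have hi : Integrable (fun t => fourier (-1) t * ψ t * (w t : ℂ)) haarAddCircle :=
    (hw.integrable.mul_const s).mono'
      (((fourier (-1)).continuous.aestronglyMeasurable.mul hψm.aestronglyMeasurable).mul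
        hwc.aestronglyMeasurable) hψw
  refine ⟨fun t => (w t : ℂ) - fourier (-1) t * ψ t * (w t : ℂ), ⟨hwc.sub hi, fun n hn => ?_⟩, ?_⟩
  · obtain ⟨k, rfl⟩ : ∃ k : ℕ, n = -(k + 1 : ℤ) := ⟨(-n - 1).toNat, by omega⟩
    have hk := hψ' (Polynomial.X ^ k)
    rw [circlePolynomial_X_pow, hw.integral_weightMeasure, hw.integral_weightMeasure] at hk
    rw [fourierCoeff, neg_neg]
    simp only [smul_sub]
    rw [integral_sub (hwc.fourier_smul _) (hi.fourier_smul _), sub_eq_zero]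
    refine Eq.trans (integral_congr_ae (Filter.Eventually.of_forall fun t => ?_))
      (hk.trans (integral_congr_ae (Filter.Eventually.of_forall fun t => ?_)))
    · simp only [add_comm (k : ℤ) 1, smul_eq_mul, Complex.real_smul]
      rw [fourier_add]
      ring
    · have h1 : fourier (k + 1 : ℤ) t * fourier (-1) t = fourier (k : ℤ) t := by
        rw [← fourier_add]; congr 2; ring
      simp only [smul_eq_mul, Complex.real_smul]
      rw [← h1]
      ring
  · simpa only [sub_sub_cancel] using hψw

theorem mainTheorem6 (w : AddCircle (2 * Real.pi) → ℝ) (hw : IsWeight w)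
    (φ : ℝ) (hφ₀ : 0 ≤ φ) (hφ : φ < Real.pi / 2) :
    (hw.IsA2 ∧ ‖hw.rieszProjection‖ ≤ 1 / Real.cos φ) ↔
      ∃ h : AddCircle (2 * Real.pi) → ℂ, MemHardyOne h ∧
        ∀ᵐ t ∂haarAddCircle, ‖(w t : ℂ) - h t‖ ≤ w t * Real.sin φ := by
  have := hw.isFiniteMeasure
  have hs : 0 ≤ Real.sin φ := Real.sin_nonneg_of_nonneg_of_le_pi hφ₀ (by linarith [Real.pi_pos])
  have hc : 0 < Real.cos φ := Real.cos_pos_of_mem_Ioo ⟨by linarith [Real.pi_pos], hφ⟩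
  rw [hw.isA2_and_norm_le_iff_polynomial hs hc (Real.sin_sq_add_cos_sq φ)]
  constructor
  · exact fun H => hw.exists_memHardyOne hs (norm_integral_circlePolynomial_le _ H)
  · rintro ⟨h, hh, hle⟩
    exact hw.norm_inner_le_of_memHardyOne hs hh hle
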